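/- For $\nu\in\mathbb C$ and $x>0$ let $K_\nu(x)=\int_0^\infty e^{-x\cosh u}\cosh(\nu u)\,du$ be the modified Bessel function of the second kind, and for $n\in\mathbb N_0$ let $p_n(x)=(-1)^n e^{x}\mathcal A^n e^{-x}$, where $\mathcal A=x^2-x\frac{d}{dx}x\frac{d}{dx}$ (so $p_0=1$, $p_1(x)=-x$, $p_2(x)=3x^2-x$; $p_n$ is a polynomial of degree $n$). Let $\alpha>1$ be real, let $[\alpha]$ be its integer part and $\{\alpha\}=\alpha-[\alpha]$ its fractional part. If $[\alpha]$ is even, then $$\frac{2^\alpha-1}{(2\pi)^{\alpha-1}}\,\Gamma(\alpha)\,\zeta(\alpha)=(-1)^{[\alpha]/2}\int_0^\infty\left(\int_0^\infty \tau^{\{\alpha\}}K_{i\tau}(x)\,e^{-x}\,p_{[\alpha]/2}(x)\,\frac{dx}{x}\right)d\tau ,$$ and if $[\alpha]$ is odd, then $$\frac{2^\alpha-1}{(2\pi)^{\alpha-1}}\,\Gamma(\alpha)\,\zeta(\alpha)=(-1)^{([\alpha]+1)/2}\int_0^\infty\left(\int_0^\infty \tau^{\{\alpha\}-1}K_{i\tau}(x)\,e^{-x}\,p_{([\alpha]+1)/2}(x)\,\frac{dx}{x}\right)d\tau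 .$$ In both cases the inner integral converges absolutely for every $\tau>0$, and the outer integral converges absolutely. -/

import Mathlib

open MeasureTheory

noncomputable section

/-- The modified Bessel function of the second kind (Macdonald function) `K_ν(x)`, for complex
order `ν` and `x > 0`, by its absolutely convergent integral representation
`K_ν(x) = ∫_0^∞ exp(-x cosh u) cosh(ν u) du`. -/
def besselK (ν : ℂ) (x : ℝ) : ℂ :=
  ∫ u in Set.Ioi (0 : ℝ), ((Real.exp (-x * Real.cosh u) : ℝ) : ℂ) * Complex.cosh (ν * (u : ℂ))

/-- The second order differential operator `𝒜 = x² - x (d/dx) x (d/dx)`. -/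
def opA (f : ℝ → ℝ) (x : ℝ) : ℝ :=
  x ^ 2 * f x - x * deriv (fun y : ℝ => y * deriv f y) x

/-- The polynomial sequence `p_n(x) = (-1)^n e^x 𝒜^n e^{-x}`. -/
def polyP (n : ℕ) (x : ℝ) : ℝ :=
  (-1) ^ n * Real.exp x * (opA^[n] (fun y : ℝ => Real.exp (-y))) x

/-- The integrand `τ^β K_{iτ}(x) e^{-x} p_m(x) / x`. -/
def zetaIntegrand (β : ℝ) (m : ℕ) (τ x : ℝ) : ℂ :=
  ((τ ^ β : ℝ) : ℂ) * besselK (Complex.I * (τ : ℂ)) x *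
    ((Real.exp (-x) * polyP m x / x : ℝ) : ℂ)

end

/-! For `m ≥ 1` the inner integral is elementary: it equals `(-1)^m π τ^(β+2m-1) / sinh (π τ)`. The
reason is that `𝒜` is symmetric for `dx/x` and `K_{iτ}` is an eigenfunction with eigenvalue `τ²`, so
each application of `𝒜` contributes a factor `τ²`. Bessel's equation is not used: Fubini turns the
moments of `K_{iτ}(x) e^{-x}` into cosine transforms of `(1 + cosh u)^{-s}`, and the eigenvalue
relation becomes their recurrence in `s` (`cosTransformCosh_succ`). The base case `s = 1` is a Beta
integral evaluated by the reflection formula (`cosTransformCosh_one`). The outer integral is then `∫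
τ^(α-1) / sinh (π τ)`; expanding `1 / sinh` geometrically gives `Γ(α)` times the sum over odd
integers, which is `(1 - 2^{-α}) ζ(α)`. -/

noncomputable section

/-- The cosine transform `∫_0^∞ cos (τ u) (1 + cosh u)^{-s} du`. -/
def cosTransformCosh (τ : ℝ) (s : ℕ) : ℝ :=
  ∫ u in Set.Ioi (0 : ℝ), Real.cos (τ * u) * ((1 + Real.cosh u) ^ s)⁻¹

end

/-! ### Cosine transforms of powers of `1 / (1 + cosh u)`. -/

lemma one_add_cosh_pos (u : ℝ) : 0 < 1 + Real.cosh u := by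
  have := Real.cosh_pos u
  linarith

lemma inv_one_add_cosh_pow_le {s : ℕ} (hs : s ≠ 0) (u : ℝ) :
    ((1 + Real.cosh u) ^ s)⁻¹ ≤ 2 * Real.exp (-1 * u) := by
  have h1 : 1 ≤ 1 + Real.cosh u := by linarith [Real.cosh_pos u]
  have h2 : Real.exp u / 2 ≤ (1 + Real.cosh u) ^ s := by
    refine le_trans ?_ (le_self_pow₀ h1 hs)
    rw [Real.cosh_eq]
    linarith [Real.exp_pos (-u)]
  calc ((1 + Real.cosh u) ^ s)⁻¹ ≤ (Real.exp u / 2)⁻¹ := by gcongr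
    _ = 2 * Real.exp (-1 * u) := by
      rw [neg_one_mul, Real.exp_neg]
      field_simp

lemma continuous_cos_mul_inv_cosh (τ : ℝ) (s : ℕ) :
    Continuous fun u : ℝ => Real.cos (τ * u) * ((1 + Real.cosh u) ^ s)⁻¹ := by
  refine Continuous.mul (by fun_prop) (Continuous.inv₀ ?_ fun u => ?_)
  · exact (continuous_const.add Real.continuous_cosh).pow s
  · exact (pow_pos (one_add_cosh_pos u) s).ne'

lemma integrableOn_cos_mul_inv_cosh (τ : ℝ) {s : ℕ} (hs : s ≠ 0) :
    IntegrableOn (fun u : ℝ => Real.cos (τ * u) * ((1 + Real.cosh u) ^ s)⁻¹) (Set.Ioi 0) := by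
  refine Integrable.mono' ((exp_neg_integrableOn_Ioi 0 one_pos).const_mul 2)
    (continuous_cos_mul_inv_cosh τ s).aestronglyMeasurable (.of_forall fun u => ?_)
  have hp := pow_pos (one_add_cosh_pos u) s
  rw [norm_mul, Real.norm_eq_abs, Real.norm_eq_abs, abs_of_pos (inv_pos.2 hp)]
  calc _ ≤ 1 * ((1 + Real.cosh u) ^ s)⁻¹ := by gcongr; exact Real.abs_cos_le_one _
    _ ≤ _ := by rw [one_mul]; exact inv_one_add_cosh_pow_le hs u

/-- Substitute `x = sigmoid u`: then `x / (1 - x) = e^u` and `dx = x (1 - x) du = du / (2 (1 + cosh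
u))`. -/
lemma integral_Ioo_cpow_eq_integral_cos (τ : ℝ) :
    (∫ x in Set.Ioo (0 : ℝ) 1, (x : ℂ) ^ (Complex.I * τ) * (1 - (x : ℂ)) ^ (-(Complex.I * τ))) =
      ∫ u : ℝ, (2 * (1 + Real.cosh u))⁻¹ • Complex.exp (Complex.I * τ * u) := by
  have h := integral_image_eq_integral_abs_deriv_smul (F := ℂ) MeasurableSet.univ
    (fun x _ => (Real.hasDerivAt_sigmoid x).hasDerivWithinAt)
    Real.sigmoid_injective.injOn
    (fun x => (x : ℂ) ^ (Complex.I * τ) * (1 - (x : ℂ)) ^ (-(Complex.I * τ)))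
  rw [Set.image_univ, Real.range_sigmoid] at h
  rw [h, Measure.restrict_univ]
  refine integral_congr_ae (.of_forall fun u => ?_)
  have hp := Real.sigmoid_pos u
  have hq : 0 < 1 - Real.sigmoid u := sub_pos.2 (Real.sigmoid_lt_one u)
  have hq' : 1 - Real.sigmoid u = Real.sigmoid u * Real.exp (-u) := by
    rw [Real.sigmoid_mul_rexp_neg, Real.sigmoid_neg]
  have hlog : Real.log (1 - Real.sigmoid u) = Real.log (Real.sigmoid u) - u := by
    rw [hq', Real.log_mul hp.ne' (Real.exp_pos _).ne', Real.log_exp]; ring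
  have hder : |Real.sigmoid u * (1 - Real.sigmoid u)| = (2 * (1 + Real.cosh u))⁻¹ := by
    rw [abs_of_pos (mul_pos hp hq), hq', Real.sigmoid_def, Real.cosh_eq, Real.exp_neg]
    have := Real.exp_pos u
    field_simp
    ring
  have hc : (1 : ℂ) - (Real.sigmoid u : ℂ) = ((1 - Real.sigmoid u : ℝ) : ℂ) := by push_cast; rfl
  simp only
  rw [hder, hc, Complex.cpow_def_of_ne_zero (by exact_mod_cast hp.ne'),
    Complex.cpow_def_of_ne_zero (by exact_mod_cast hq.ne'), ← Complex.exp_add,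
    ← Complex.ofReal_log hp.le, ← Complex.ofReal_log hq.le, hlog]
  congr 2
  push_cast
  ring

lemma betaIntegral_one_add_one_sub {τ : ℝ} (hτ : τ ≠ 0) :
    Complex.betaIntegral (1 + Complex.I * τ) (1 - Complex.I * τ) =
      ((Real.pi * τ / Real.sinh (Real.pi * τ) : ℝ) : ℂ) := by
  have h := Complex.Gamma_mul_Gamma_eq_betaIntegral (s := 1 + Complex.I * τ)
    (t := 1 - Complex.I * τ) (by simp) (by simp)
  have h2 : (1 + Complex.I * τ) + (1 - Complex.I * (τ : ℂ)) = 2 := by ring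
  have hne : Complex.I * (τ : ℂ) ≠ 0 := by simp [hτ]
  rw [h2, Complex.Gamma_ofNat_eq_factorial] at h
  simp only [Nat.factorial_one, Nat.cast_one, one_mul] at h
  rw [← h, add_comm, Complex.Gamma_add_one _ hne, mul_assoc, Complex.Gamma_mul_Gamma_one_sub,
    show (Real.pi : ℂ) * (Complex.I * τ) = (Real.pi * τ) * Complex.I by ring, Complex.sin_mul_I]
  have hs : Real.sinh (Real.pi * τ) ≠ 0 := by
    rw [Ne, Real.sinh_eq_zero]; exact mul_ne_zero Real.pi_ne_zero hτ
  have hs' : Complex.sinh ((Real.pi : ℂ) * τ) ≠ 0 := by exact_mod_cast hs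
  push_cast
  field_simp

lemma cosTransformCosh_one {τ : ℝ} (hτ : τ ≠ 0) :
    cosTransformCosh τ 1 = Real.pi * τ / Real.sinh (Real.pi * τ) := by
  have h := betaIntegral_one_add_one_sub hτ
  have hb : Complex.betaIntegral (1 + Complex.I * τ) (1 - Complex.I * τ) =
      ∫ u : ℝ, (2 * (1 + Real.cosh u))⁻¹ • Complex.exp (Complex.I * τ * u) := by
    rw [← integral_Ioo_cpow_eq_integral_cos, Complex.betaIntegral,
      intervalIntegral.integral_of_le zero_le_one, integral_Ioc_eq_integral_Ioo]
    refine integral_congr_ae (.of_forall fun x => ?_)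
    simp only
    rw [show (1 + Complex.I * τ - 1 : ℂ) = Complex.I * τ by ring,
      show (1 - Complex.I * τ - 1 : ℂ) = -(Complex.I * τ) by ring]
  rw [hb] at h
  have hint : Integrable fun u : ℝ =>
      (2 * (1 + Real.cosh u))⁻¹ • Complex.exp (Complex.I * τ * u) := by
    -- A non-integrable function has Bochner integral `0`, whereas the value found is nonzero.
    by_contra hn
    rw [integral_undef hn] at h
    have hs : Real.sinh (Real.pi * τ) ≠ 0 := by
      rw [Ne, Real.sinh_eq_zero]; exact mul_ne_zero Real.pi_ne_zero hτ
    have := mul_ne_zero Real.pi_ne_zero hτ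
    exact div_ne_zero this hs (by exact_mod_cast h.symm)
  have hre := congrArg Complex.re h
  rw [Complex.ofReal_re] at hre
  have hre' : (∫ u : ℝ, ((2 * (1 + Real.cosh u))⁻¹ • Complex.exp (Complex.I * τ * u)).re) =
      Real.pi * τ / Real.sinh (Real.pi * τ) := by
    rw [← hre]; exact integral_re hint
  rw [← hre']
  -- The real part is even in `u`; folding to the half-line gives a factor 2 that cancels the one in
  -- the denominator.
  have habs := integral_comp_abs (f := fun u : ℝ => Real.cos (τ * u) * (2 * (1 + Real.cosh u))⁻¹)
  have : (fun u : ℝ => ((2 * (1 + Real.cosh u))⁻¹ • Complex.exp (Complex.I * τ * u)).re) =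
      fun u : ℝ => Real.cos (τ * |u|) * (2 * (1 + Real.cosh |u|))⁻¹ := by
    ext u
    rw [Complex.smul_re, smul_eq_mul, mul_comm, Real.cosh_abs,
      show Complex.I * (τ : ℂ) * u = ((τ * u : ℝ) : ℂ) * Complex.I by push_cast; ring,
      Complex.exp_ofReal_mul_I_re]
    congr 1
    rcases abs_cases u with ⟨h, -⟩ | ⟨h, -⟩ <;> simp [h]
  rw [this, habs, ← integral_const_mul, cosTransformCosh]
  refine integral_congr_ae (.of_forall fun u => ?_)
  have := one_add_cosh_pos u
  simp only [pow_one]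
  field_simp

lemma tendsto_inv_one_add_cosh_pow {s : ℕ} (hs : s ≠ 0) :
    Filter.Tendsto (fun u : ℝ => ((1 + Real.cosh u) ^ s)⁻¹) Filter.atTop (nhds 0) := by
  refine squeeze_zero (fun u => (inv_pos.2 (pow_pos (one_add_cosh_pos u) s)).le)
    (fun u => inv_one_add_cosh_pow_le hs u) ?_
  have := (Real.tendsto_exp_neg_atTop_nhds_zero).const_mul 2
  simpa using this

/-- With `g = (1 + cosh u)^{-s}`, one has `g'' = s² g - s (2s+1) (1 + cosh u)^{-(s+1)}`; integrate
`cos (τ u) g''` by parts twice. -/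
lemma cosTransformCosh_succ (τ : ℝ) {s : ℕ} (hs : s ≠ 0) :
    (s * (2 * s + 1) : ℝ) * cosTransformCosh τ (s + 1) =
      ((s : ℝ) ^ 2 + τ ^ 2) * cosTransformCosh τ s := by
  -- The Wronskian `cos(τu) g' - (cos(τu))' g`, whose derivative is `cos(τu) (g'' + τ² g)`. It
  -- vanishes at `0` and at infinity.
  let F : ℝ → ℝ := fun u => Real.cos (τ * u) * (-s * Real.sinh u * ((1 + Real.cosh u) ^ (s + 1))⁻¹) +
    τ * Real.sin (τ * u) * ((1 + Real.cosh u) ^ s)⁻¹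
  let F' : ℝ → ℝ := fun u =>
    ((s : ℝ) ^ 2 + τ ^ 2) * (Real.cos (τ * u) * ((1 + Real.cosh u) ^ s)⁻¹) -
      (s * (2 * s + 1) : ℝ) * (Real.cos (τ * u) * ((1 + Real.cosh u) ^ (s + 1))⁻¹)
  have hi0 := (integrableOn_cos_mul_inv_cosh τ hs).const_mul ((s : ℝ) ^ 2 + τ ^ 2)
  have hi1 := (integrableOn_cos_mul_inv_cosh τ s.succ_ne_zero).const_mul (s * (2 * s + 1) : ℝ)
  have hder : ∀ u ∈ Set.Ici (0 : ℝ), HasDerivAt F (F' u) u := by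
    intro u _
    have hpos := one_add_cosh_pos u
    have hc : HasDerivAt (fun u => Real.cos (τ * u)) (-Real.sin (τ * u) * τ) u := by
      simpa using ((hasDerivAt_id u).const_mul τ).cos
    have hsn : HasDerivAt (fun u => Real.sin (τ * u)) (Real.cos (τ * u) * τ) u := by
      simpa using ((hasDerivAt_id u).const_mul τ).sin
    have hp (n : ℕ) : HasDerivAt (fun u => ((1 + Real.cosh u) ^ n)⁻¹)
        (-(n * Real.sinh u) * ((1 + Real.cosh u) ^ (n + 1))⁻¹) u := by
      refine ((((Real.hasDerivAt_cosh u).const_add 1).fun_pow n).fun_inv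
        (pow_pos hpos n).ne').congr_deriv ?_
      cases n with
      | zero => simp
      | succ k =>
        simp only [Nat.add_sub_cancel]
        field_simp
        ring
    have := (hc.mul (((Real.hasDerivAt_sinh u).const_mul (-s : ℝ)).mul (hp (s + 1)))).add
      ((hsn.const_mul τ).mul (hp s))
    refine this.congr_deriv ?_
    have hsq : Real.sinh u ^ 2 = (Real.cosh u - 1) * (1 + Real.cosh u) := by
      rw [Real.sinh_sq]; ring
    simp only [F', pow_succ, Pi.mul_apply]
    push_cast
    generalize Real.cosh u = c at hsq hpos ⊢
    field_simp
    linear_combination (s + 1 : ℝ) * s * Real.cos (τ * u) * hsq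
  have hlim : Filter.Tendsto F Filter.atTop (nhds 0) := by
    have h0 := tendsto_inv_one_add_cosh_pow hs
    refine squeeze_zero_norm (a := fun u => (s + |τ|) * ((1 + Real.cosh u) ^ s)⁻¹) (fun u => ?_)
      (by simpa using h0.const_mul (s + |τ|))
    have hpos := one_add_cosh_pos u
    have hsinh : |Real.sinh u| ≤ 1 + Real.cosh u := by
      rw [abs_le]
      constructor <;> rw [Real.sinh_eq, Real.cosh_eq] <;>
        linarith [Real.exp_pos u, Real.exp_pos (-u)]
    have hx : |Real.sinh u| * ((1 + Real.cosh u) ^ (s + 1))⁻¹ ≤ ((1 + Real.cosh u) ^ s)⁻¹ := by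
      calc _ ≤ (1 + Real.cosh u) * ((1 + Real.cosh u) ^ (s + 1))⁻¹ := by gcongr
        _ = _ := by rw [pow_succ]; field_simp
    have hinv (n : ℕ) : 0 < ((1 + Real.cosh u) ^ n)⁻¹ := inv_pos.2 (pow_pos hpos n)
    calc ‖F u‖ ≤ |Real.cos (τ * u)| * (s * |Real.sinh u| * ((1 + Real.cosh u) ^ (s + 1))⁻¹) +
        |τ| * |Real.sin (τ * u)| * ((1 + Real.cosh u) ^ s)⁻¹ := by
          refine (norm_add_le _ _).trans (le_of_eq ?_)
          simp only [Real.norm_eq_abs, abs_mul, abs_neg, Nat.abs_cast, abs_of_pos (hinv _)]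
      _ ≤ 1 * (s * ((1 + Real.cosh u) ^ s)⁻¹) + |τ| * 1 * ((1 + Real.cosh u) ^ s)⁻¹ := by
          have h1 := Real.abs_cos_le_one (τ * u)
          have h2 := Real.abs_sin_le_one (τ * u)
          have h3 := (hinv s).le
          rw [mul_assoc (s : ℝ)]
          refine add_le_add (mul_le_mul h1 (by gcongr) (by positivity) one_pos.le) (by gcongr)
      _ = _ := by ring
  have hmain := integral_Ioi_of_hasDerivAt_of_tendsto' hder (hi0.sub hi1) hlim
  have hF0 : F 0 = 0 := by simp [F]
  rw [hF0, sub_zero, integral_sub hi0 hi1, integral_const_mul, integral_const_mul] at hmain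
  simp only [cosTransformCosh]
  linarith

/-! ### Moments of the Macdonald function. -/

noncomputable section

/-- The Macdonald function `K_{iτ}(x)` of imaginary order as a real integral. -/
def besselKImag (τ x : ℝ) : ℝ :=
  ∫ u in Set.Ioi (0 : ℝ), Real.exp (-x * Real.cosh u) * Real.cos (τ * u)

open Polynomial in
/-- The operator on polynomials that `opA` induces under `q ↦ x q(x) e^{-x}`. -/
def polyOpA (q : ℝ[X]) : ℝ[X] :=
  X ^ 2 * q - derivative (X * (derivative (X * q) - X * q)) + X * (derivative (X * q) - X * q)

end

lemma besselK_I_mul (τ x : ℝ) : besselK (Complex.I * τ) x = besselKImag τ x := by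
  rw [besselK, besselKImag, ← integral_complex_ofReal]
  congr 1
  ext u
  rw [show Complex.I * (τ : ℂ) * u = ((τ * u : ℝ) : ℂ) * Complex.I by push_cast; ring,
    Complex.cosh_mul_I, ← Complex.ofReal_cos, ← Complex.ofReal_mul]

lemma integrableOn_pow_mul_exp (k : ℕ) {r : ℝ} (hr : 0 < r) :
    IntegrableOn (fun x : ℝ => x ^ k * Real.exp (-(r * x))) (Set.Ioi 0) := by
  have h := integrableOn_rpow_mul_exp_neg_mul_rpow (p := 1) (s := k) (b := r)
    (by linarith [k.cast_nonneg (α := ℝ)]) one_pos hr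
  simpa using h

lemma integral_pow_mul_exp (k : ℕ) {r : ℝ} (hr : 0 < r) :
    ∫ x in Set.Ioi (0 : ℝ), x ^ k * Real.exp (-(r * x)) = k.factorial * (r ^ (k + 1))⁻¹ := by
  have h := Real.integral_rpow_mul_exp_neg_mul_Ioi (a := k + 1) (r := r) (by positivity) hr
  rw [Real.Gamma_nat_eq_factorial, add_sub_cancel_right] at h
  simp only [Real.rpow_natCast] at h
  rw [h, mul_comm, one_div, Real.inv_rpow hr.le]
  norm_cast

lemma bessel_kernel_eq (τ x u : ℝ) (k : ℕ) :
    Real.exp (-x * Real.cosh u) * Real.cos (τ * u) * (Real.exp (-x) * x ^ k) =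
      Real.cos (τ * u) * (x ^ k * Real.exp (-((1 + Real.cosh u) * x))) := by
  rw [show -((1 + Real.cosh u) * x) = -x * Real.cosh u + -x by ring, Real.exp_add]
  ring

lemma integrable_bessel_kernel (τ : ℝ) (k : ℕ) :
    Integrable (Function.uncurry fun x u : ℝ =>
      Real.exp (-x * Real.cosh u) * Real.cos (τ * u) * (Real.exp (-x) * x ^ k))
      ((volume.restrict (Set.Ioi 0)).prod (volume.restrict (Set.Ioi 0))) := by
  have hcont : Continuous (Function.uncurry fun x u : ℝ =>
      Real.exp (-x * Real.cosh u) * Real.cos (τ * u) * (Real.exp (-x) * x ^ k)) := by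
    have := Real.continuous_cosh
    unfold Function.uncurry
    fun_prop
  rw [integrable_prod_iff' hcont.aestronglyMeasurable]
  simp only [Function.uncurry, bessel_kernel_eq]
  refine ⟨.of_forall fun u => (integrableOn_pow_mul_exp k (one_add_cosh_pos u)).const_mul _, ?_⟩
  have h : (fun u : ℝ => ∫ x in Set.Ioi (0 : ℝ),
      ‖Real.cos (τ * u) * (x ^ k * Real.exp (-((1 + Real.cosh u) * x)))‖) =
      fun u => k.factorial * ‖Real.cos (τ * u) * ((1 + Real.cosh u) ^ (k + 1))⁻¹‖ := by
    ext u
    have hp := pow_pos (one_add_cosh_pos u) (k + 1)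
    rw [norm_mul, norm_inv, Real.norm_of_nonneg hp.le, mul_left_comm,
      ← integral_pow_mul_exp k (one_add_cosh_pos u), ← integral_const_mul]
    refine setIntegral_congr_fun measurableSet_Ioi fun x hx => ?_
    have hx' : 0 < x := hx
    simp only [norm_mul, Real.norm_eq_abs, abs_pow, abs_of_pos hx', Real.abs_exp]
  rw [h]
  exact ((integrableOn_cos_mul_inv_cosh τ k.succ_ne_zero).norm).const_mul _

lemma integrableOn_besselKImag_mul_pow (τ : ℝ) (k : ℕ) :
    IntegrableOn (fun x => besselKImag τ x * (Real.exp (-x) * x ^ k)) (Set.Ioi 0) := by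
  have h := (integrable_bessel_kernel τ k).integral_prod_left
  simp only [Function.uncurry, integral_mul_const] at h
  exact h

lemma integral_besselKImag_mul_pow (τ : ℝ) (k : ℕ) :
    ∫ x in Set.Ioi (0 : ℝ), besselKImag τ x * (Real.exp (-x) * x ^ k) =
      k.factorial * cosTransformCosh τ (k + 1) := by
  have h := integral_integral_swap (integrable_bessel_kernel τ k)
  simp only [integral_mul_const] at h
  simp only [besselKImag]
  rw [h, cosTransformCosh, ← integral_const_mul]
  refine integral_congr_ae (.of_forall fun u => ?_)
  simp only [bessel_kernel_eq]
  rw [integral_const_mul, integral_pow_mul_exp k (one_add_cosh_pos u)]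
  ring

open Polynomial

lemma integrableOn_besselKImag_mul_eval (τ : ℝ) (q : ℝ[X]) :
    IntegrableOn (fun x => besselKImag τ x * (Real.exp (-x) * q.eval x)) (Set.Ioi 0) := by
  induction q using Polynomial.induction_on' with
  | add p q hp hq =>
    simp only [eval_add, mul_add]
    exact hp.add hq
  | monomial n a =>
    refine ((integrableOn_besselKImag_mul_pow τ n).const_mul a).congr (.of_forall fun x => ?_)
    simp only [eval_monomial]
    ring

lemma polyOpA_add (p q : ℝ[X]) : polyOpA (p + q) = polyOpA p + polyOpA q := by
  simp only [polyOpA, mul_add, derivative_add, mul_sub, derivative_sub]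
  ring

lemma eval_polyOpA_monomial (n : ℕ) (a x : ℝ) :
    (polyOpA (monomial n a)).eval x =
      (2 * n + 3) * a * x ^ (n + 1) - (n + 1) ^ 2 * a * x ^ n := by
  have h : (X : ℝ[X]) * monomial n a = C a * X ^ (n + 1) := by
    rw [← C_mul_X_pow_eq_monomial]; ring
  simp only [polyOpA, h]
  simp [derivative_mul]
  cases n with
  | zero => simp; ring
  | succ k => simp; ring

/-- The eigenvalue relation for `𝒜` in integrated form; on the monomial of degree `n` it is the
recurrence `cosTransformCosh_succ` at `s = n + 1`. -/
lemma integral_besselKImag_mul_polyOpA (τ : ℝ) (q : ℝ[X]) :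
    ∫ x in Set.Ioi (0 : ℝ), besselKImag τ x * (Real.exp (-x) * (polyOpA q).eval x) =
      τ ^ 2 * ∫ x in Set.Ioi (0 : ℝ), besselKImag τ x * (Real.exp (-x) * q.eval x) := by
  induction q using Polynomial.induction_on' with
  | add p q hp hq =>
    simp only [polyOpA_add, eval_add, mul_add]
    rw [integral_add (integrableOn_besselKImag_mul_eval τ _)
      (integrableOn_besselKImag_mul_eval τ _), integral_add (integrableOn_besselKImag_mul_eval τ _)
      (integrableOn_besselKImag_mul_eval τ _), hp, hq, mul_add]
  | monomial n a =>
    have h1 := (integrableOn_besselKImag_mul_pow τ (n + 1)).const_mul ((2 * n + 3) * a)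
    have h0 := (integrableOn_besselKImag_mul_pow τ n).const_mul ((n + 1) ^ 2 * a)
    have e1 : ∀ x : ℝ, besselKImag τ x * (Real.exp (-x) * (polyOpA (monomial n a)).eval x) =
        (2 * n + 3) * a * (besselKImag τ x * (Real.exp (-x) * x ^ (n + 1))) -
          (n + 1) ^ 2 * a * (besselKImag τ x * (Real.exp (-x) * x ^ n)) := fun x => by
      rw [eval_polyOpA_monomial]; ring
    have e0 : ∀ x : ℝ, besselKImag τ x * (Real.exp (-x) * (monomial n a).eval x) =
        a * (besselKImag τ x * (Real.exp (-x) * x ^ n)) := fun x => by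
      rw [eval_monomial]; ring
    simp only [e1, e0]
    rw [integral_sub h1 h0, integral_const_mul, integral_const_mul, integral_const_mul,
      integral_besselKImag_mul_pow, integral_besselKImag_mul_pow, Nat.factorial_succ]
    have hr := cosTransformCosh_succ τ n.succ_ne_zero
    simp only [Nat.succ_eq_add_one] at hr
    push_cast at hr ⊢
    linear_combination (a * n.factorial) * hr

/-! ### Iterates of `𝒜` on `e^{-x}` and the inner integral. -/

lemma opA_mul_eval_mul_exp (q : ℝ[X]) :
    opA (fun y => y * q.eval y * Real.exp (-y)) =
      fun y => y * (polyOpA q).eval y * Real.exp (-y) := by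
  have hd (p : ℝ[X]) (y : ℝ) : HasDerivAt (fun y => p.eval y * Real.exp (-y))
      ((derivative p - p).eval y * Real.exp (-y)) y := by
    refine ((p.hasDerivAt y).mul (hasDerivAt_neg y).exp).congr_deriv ?_
    rw [eval_sub]; ring
  ext x
  have h1 : deriv (fun y => y * q.eval y * Real.exp (-y)) =
      fun y => (derivative (X * q) - X * q).eval y * Real.exp (-y) := by
    ext y
    have h := (hd (X * q) y).deriv
    simp only [eval_mul (p := X) (q := q), eval_X] at h
    exact h
  have h2 : deriv (fun y => y * ((derivative (X * q) - X * q).eval y * Real.exp (-y))) x =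
      (derivative (X * (derivative (X * q) - X * q)) -
        X * (derivative (X * q) - X * q)).eval x * Real.exp (-x) := by
    rw [← (hd (X * (derivative (X * q) - X * q)) x).deriv]
    congr 1
    ext y
    rw [eval_mul, eval_X]; ring
  rw [opA, h1, h2, polyOpA, eval_add, eval_sub, eval_sub]
  generalize derivative (X * q) - X * q = p
  simp only [eval_mul, eval_pow, eval_X]
  ring

/-- The first application produces the factor `x` that later cancels the `1/x` of the measure, so
the iteration of `polyOpA` starts at `1`. -/
lemma opA_exp_neg : opA (fun y => Real.exp (-y)) = fun y => y * Real.exp (-y) := by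
  have h1 : deriv (fun y : ℝ => Real.exp (-y)) = fun y => -Real.exp (-y) := by
    ext y
    rw [(hasDerivAt_neg y).exp.deriv]; ring
  ext x
  have h2 : HasDerivAt (fun y : ℝ => y * -Real.exp (-y))
      (1 * -Real.exp (-x) + x * -(Real.exp (-x) * -1)) x :=
    (hasDerivAt_id x).mul (hasDerivAt_neg x).exp.neg
  rw [opA, h1, h2.deriv]
  ring

lemma iterate_opA_exp_neg (n : ℕ) :
    opA^[n + 1] (fun y => Real.exp (-y)) =
      fun y => y * (polyOpA^[n] 1).eval y * Real.exp (-y) := by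
  induction n with
  | zero => simpa using opA_exp_neg
  | succ n ih =>
    rw [Function.iterate_succ_apply', ih, opA_mul_eval_mul_exp, Function.iterate_succ_apply']

lemma polyP_succ (n : ℕ) (x : ℝ) :
    polyP (n + 1) x = (-1) ^ (n + 1) * (x * (polyOpA^[n] 1).eval x) := by
  rw [polyP, iterate_opA_exp_neg]
  simp only [Real.exp_neg]
  have := Real.exp_pos x
  field_simp

lemma integral_besselKImag_mul_iterate {τ : ℝ} (hτ : τ ≠ 0) (n : ℕ) :
    ∫ x in Set.Ioi (0 : ℝ), besselKImag τ x * (Real.exp (-x) * (polyOpA^[n] 1).eval x) =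
      τ ^ (2 * n) * (Real.pi * τ / Real.sinh (Real.pi * τ)) := by
  induction n with
  | zero =>
    have h := integral_besselKImag_mul_pow τ 0
    rw [zero_add, cosTransformCosh_one hτ] at h
    simpa using h
  | succ n ih =>
    rw [Function.iterate_succ_apply', integral_besselKImag_mul_polyOpA, ih]
    ring

lemma zetaIntegrand_succ (β : ℝ) (n : ℕ) (τ : ℝ) {x : ℝ} (hx : x ≠ 0) :
    zetaIntegrand β (n + 1) τ x = (((-1) ^ (n + 1) * τ ^ β *
      (besselKImag τ x * (Real.exp (-x) * (polyOpA^[n] 1).eval x)) : ℝ) : ℂ) := by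
  rw [zetaIntegrand, besselK_I_mul, polyP_succ, ← Complex.ofReal_mul, ← Complex.ofReal_mul]
  congr 1
  field_simp

lemma integrableOn_zetaIntegrand_succ (β : ℝ) (n : ℕ) (τ : ℝ) :
    IntegrableOn (zetaIntegrand β (n + 1) τ) (Set.Ioi 0) := by
  refine IntegrableOn.congr_fun (f := fun x : ℝ => (((-1) ^ (n + 1) * τ ^ β *
      (besselKImag τ x * (Real.exp (-x) * (polyOpA^[n] 1).eval x)) : ℝ) : ℂ)) ?_
    (fun x hx => (zetaIntegrand_succ β n τ (ne_of_gt hx)).symm) measurableSet_Ioi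
  exact ((integrableOn_besselKImag_mul_eval τ _).const_mul _).ofReal

lemma integral_zetaIntegrand_succ (β : ℝ) (n : ℕ) {τ : ℝ} (hτ : 0 < τ) :
    ∫ x in Set.Ioi (0 : ℝ), zetaIntegrand β (n + 1) τ x =
      (((-1) ^ (n + 1) * Real.pi * (τ ^ (β + 2 * n + 1) / Real.sinh (Real.pi * τ)) : ℝ) : ℂ) := by
  rw [setIntegral_congr_fun measurableSet_Ioi
    (fun x hx => zetaIntegrand_succ β n τ (ne_of_gt hx)), integral_complex_ofReal,
    integral_const_mul, integral_besselKImag_mul_iterate hτ.ne', Real.rpow_add_one hτ.ne',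
    Real.rpow_add hτ, show (2 * n : ℝ) = ((2 * n : ℕ) : ℝ) by push_cast; rfl, Real.rpow_natCast]
  congr 1
  ring

/-! ### The integral of `t^(α-1) / sinh (π t)` and the zeta function. -/

/-- One bound serves both ends: the factor `x` controls the pole of `1 / sinh` at `0`, the
exponential controls infinity. -/
lemma mul_exp_half_le_sinh {x : ℝ} (hx : 0 ≤ x) : x * Real.exp (x / 2) / 2 ≤ Real.sinh x := by
  have h1 : x / 2 ≤ Real.sinh (x / 2) := Real.self_le_sinh_iff.2 (by linarith)
  have h2 : Real.exp (x / 2) / 2 ≤ Real.cosh (x / 2) := by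
    rw [Real.cosh_eq]; linarith [Real.exp_pos (-(x / 2))]
  calc x * Real.exp (x / 2) / 2 = 2 * (x / 2) * (Real.exp (x / 2) / 2) := by ring
    _ ≤ 2 * Real.sinh (x / 2) * Real.cosh (x / 2) := by gcongr
    _ = Real.sinh x := by rw [← Real.sinh_two_mul]; congr 1; ring

lemma integrableOn_rpow_div_sinh {α : ℝ} (hα : 1 < α) :
    IntegrableOn (fun t : ℝ => t ^ (α - 1) / Real.sinh (Real.pi * t)) (Set.Ioi 0) := by
  have hdom := (integrableOn_rpow_mul_exp_neg_mul_rpow (p := 1) (s := α - 2) (b := Real.pi / 2)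
    (by linarith) one_pos (by positivity)).const_mul (2 / Real.pi)
  refine Integrable.mono' hdom (Measurable.aestronglyMeasurable ?_)
    ((ae_restrict_iff' measurableSet_Ioi).2 (.of_forall fun t ht => ?_))
  · have := Real.continuous_sinh.measurable
    fun_prop
  · have ht' : 0 < t := ht
    have hpt : 0 < Real.pi * t := by positivity
    have hle := mul_exp_half_le_sinh hpt.le
    have hpos : 0 < Real.pi * t * Real.exp (Real.pi * t / 2) / 2 := by positivity
    rw [Real.norm_of_nonneg (div_nonneg (by positivity) (hpos.le.trans hle)), Real.rpow_one,
      show α - 1 = α - 2 + 1 by ring, Real.rpow_add_one ht'.ne']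
    calc _ ≤ t ^ (α - 2) * t / (Real.pi * t * Real.exp (Real.pi * t / 2) / 2) := by gcongr
      _ = _ := by
        rw [show -(Real.pi / 2) * t = -(Real.pi * t / 2) by ring, Real.exp_neg]
        field_simp

lemma hasSum_exp_odd_inv_sinh {x : ℝ} (hx : 0 < x) :
    HasSum (fun k : ℕ => 2 * Real.exp (-((2 * k + 1) * x))) (Real.sinh x)⁻¹ := by
  have h := (hasSum_geometric_of_lt_one (Real.exp_pos (-(2 * x))).le
    (Real.exp_lt_one_iff.2 (by linarith))).mul_left (2 * Real.exp (-x))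
  have hterm : (fun k : ℕ => 2 * Real.exp (-x) * Real.exp (-(2 * x)) ^ k) =
      fun k : ℕ => 2 * Real.exp (-((2 * k + 1) * x)) := by
    ext k
    rw [← Real.exp_nat_mul, mul_assoc, ← Real.exp_add]
    ring_nf
  have hval : 2 * Real.exp (-x) * (1 - Real.exp (-(2 * x)))⁻¹ = (Real.sinh x)⁻¹ := by
    have hs := (Real.sinh_pos_iff.2 hx).ne'
    have h1 : 1 - Real.exp (-(2 * x)) ≠ 0 :=
      (sub_pos.2 (Real.exp_lt_one_iff.2 (by linarith))).ne'
    rw [← div_eq_mul_inv, div_eq_iff h1, eq_inv_mul_iff_mul_eq₀ hs, Real.sinh_eq,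
      show -(2 * x) = -x + -x by ring, Real.exp_add]
    have : Real.exp x * Real.exp (-x) = 1 := by rw [← Real.exp_add]; simp
    linear_combination this
  rwa [hterm, hval] at h

lemma integral_rpow_div_sinh {α : ℝ} (hα : 1 < α) :
    ∫ t in Set.Ioi (0 : ℝ), t ^ (α - 1) / Real.sinh (Real.pi * t) =
      2 * Real.pi ^ (-α) * Real.Gamma α * ∑' k : ℕ, 1 / ((2 * k + 1 : ℕ) : ℝ) ^ α := by
  have hr (k : ℕ) : 0 < (2 * k + 1) * Real.pi := by positivity
  have hint (k : ℕ) : IntegrableOn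
      (fun t : ℝ => 2 * (t ^ (α - 1) * Real.exp (-((2 * k + 1) * Real.pi * t)))) (Set.Ioi 0) := by
    have h := (integrableOn_rpow_mul_exp_neg_mul_rpow (p := 1) (s := α - 1)
      (by linarith) one_pos (hr k)).const_mul 2
    simp only [Real.rpow_one, neg_mul] at h ⊢
    exact h
  have hval (k : ℕ) : ∫ t in Set.Ioi (0 : ℝ),
      2 * (t ^ (α - 1) * Real.exp (-((2 * k + 1) * Real.pi * t))) =
      2 * Real.pi ^ (-α) * Real.Gamma α * (1 / ((2 * k + 1 : ℕ) : ℝ) ^ α) := by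
    rw [integral_const_mul, Real.integral_rpow_mul_exp_neg_mul_Ioi (by linarith) (hr k), one_div,
      Real.inv_rpow (hr k).le, Real.mul_rpow (by positivity) Real.pi_pos.le,
      Real.rpow_neg Real.pi_pos.le]
    push_cast
    rw [mul_inv]
    ring
  have hsum : Summable fun k : ℕ => 1 / ((2 * k + 1 : ℕ) : ℝ) ^ α :=
    (Real.summable_one_div_nat_rpow.2 hα).comp_injective (i := fun k : ℕ => 2 * k + 1)
      fun a b h => by simpa using h
  have hnorm (k : ℕ) : ∫ t in Set.Ioi (0 : ℝ),
      ‖2 * (t ^ (α - 1) * Real.exp (-((2 * k + 1) * Real.pi * t)))‖ =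
      2 * Real.pi ^ (-α) * Real.Gamma α * (1 / ((2 * k + 1 : ℕ) : ℝ) ^ α) := by
    rw [← hval]
    refine setIntegral_congr_fun measurableSet_Ioi fun t ht => ?_
    have ht' : 0 < t := ht
    exact Real.norm_of_nonneg (by positivity)
  have h := hasSum_integral_of_summable_integral_norm hint (by
    simp only [hnorm]; exact hsum.mul_left _)
  rw [← tsum_mul_left, ← tsum_congr hval, h.tsum_eq]
  refine setIntegral_congr_fun measurableSet_Ioi fun t ht => ?_
  have ht' : 0 < t := ht
  have hs := (hasSum_exp_odd_inv_sinh (mul_pos Real.pi_pos ht')).mul_left (t ^ (α - 1))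
  rw [div_eq_mul_inv, ← hs.tsum_eq]
  refine tsum_congr fun k => ?_
  rw [mul_assoc _ Real.pi t]
  ring

lemma riemannZeta_eq_ofReal_tsum {α : ℝ} (hα : 1 < α) :
    riemannZeta (α : ℂ) = ((∑' n : ℕ, 1 / (n : ℝ) ^ α : ℝ) : ℂ) := by
  rw [zeta_eq_tsum_one_div_nat_cpow (by simpa using hα), Complex.ofReal_tsum]
  refine tsum_congr fun n => ?_
  rw [Complex.ofReal_div, Complex.ofReal_one, Complex.ofReal_cpow n.cast_nonneg,
    Complex.ofReal_natCast]

/-- The even terms contribute `2^{-α}` times the whole sum. The term `n = 0` is `1 / 0 = 0`. -/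
lemma tsum_odd_one_div_rpow {α : ℝ} (hα : 1 < α) :
    2 ^ α * ∑' k : ℕ, 1 / ((2 * k + 1 : ℕ) : ℝ) ^ α =
      (2 ^ α - 1) * ∑' n : ℕ, 1 / (n : ℝ) ^ α := by
  have hsum := Real.summable_one_div_nat_rpow.2 hα
  have heven : Summable fun k : ℕ => 1 / ((2 * k : ℕ) : ℝ) ^ α :=
    hsum.comp_injective (i := fun k : ℕ => 2 * k) fun a b h => by simpa using h
  have hodd : Summable fun k : ℕ => 1 / ((2 * k + 1 : ℕ) : ℝ) ^ α :=
    hsum.comp_injective (i := fun k : ℕ => 2 * k + 1) fun a b h => by simpa using h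
  have h := tsum_even_add_odd (f := fun n : ℕ => 1 / (n : ℝ) ^ α) heven hodd
  have h2 : (2 : ℝ) ^ α ≠ 0 := by positivity
  have he : ∑' k : ℕ, 1 / ((2 * k : ℕ) : ℝ) ^ α = (2 ^ α)⁻¹ * ∑' n : ℕ, 1 / (n : ℝ) ^ α := by
    rw [← tsum_mul_left]
    refine tsum_congr fun k => ?_
    rw [Nat.cast_mul, Real.mul_rpow (by simp) k.cast_nonneg, Nat.cast_ofNat, one_div, mul_inv,
      one_div]
  rw [he] at h
  generalize ∑' k : ℕ, 1 / ((2 * k + 1 : ℕ) : ℝ) ^ α = A at h ⊢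
  generalize ∑' n : ℕ, 1 / (n : ℝ) ^ α = Z at h ⊢
  field_simp at h
  linear_combination h

/-! ### Both parities at once. -/

lemma zeta_eq_integral_zetaIntegrand {α β : ℝ} (hα : 1 < α) (n : ℕ) (hβ : β + 2 * n + 2 = α) :
    (∀ τ : ℝ, 0 < τ → IntegrableOn (zetaIntegrand β (n + 1) τ) (Set.Ioi 0)) ∧
      IntegrableOn (fun τ : ℝ => ∫ x in Set.Ioi (0 : ℝ), zetaIntegrand β (n + 1) τ x)
        (Set.Ioi 0) ∧
      (((2 ^ α - 1) / (2 * Real.pi) ^ (α - 1) * Real.Gamma α : ℝ) : ℂ) * riemannZeta (α : ℂ) =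
        (-1) ^ (n + 1) *
          ∫ τ in Set.Ioi (0 : ℝ), ∫ x in Set.Ioi (0 : ℝ), zetaIntegrand β (n + 1) τ x := by
  have hinner : Set.EqOn (fun τ : ℝ => ∫ x in Set.Ioi (0 : ℝ), zetaIntegrand β (n + 1) τ x)
      (fun τ => (((-1) ^ (n + 1) * Real.pi * (τ ^ (α - 1) / Real.sinh (Real.pi * τ)) : ℝ) : ℂ))
      (Set.Ioi 0) := fun τ hτ => by
    simp only
    rw [integral_zetaIntegrand_succ β n hτ, show β + 2 * n + 1 = α - 1 by linarith]
  refine ⟨fun τ _ => integrableOn_zetaIntegrand_succ β n τ, ?_, ?_⟩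
  · refine IntegrableOn.congr_fun ?_ hinner.symm measurableSet_Ioi
    exact ((integrableOn_rpow_div_sinh hα).const_mul _).ofReal
  · rw [setIntegral_congr_fun measurableSet_Ioi hinner, integral_complex_ofReal,
      integral_const_mul, integral_rpow_div_sinh hα, riemannZeta_eq_ofReal_tsum hα]
    have hodd := tsum_odd_one_div_rpow hα
    generalize ∑' k : ℕ, 1 / ((2 * k + 1 : ℕ) : ℝ) ^ α = A at hodd
    generalize ∑' n : ℕ, 1 / (n : ℝ) ^ α = Z at hodd
    have hsign : ((-1 : ℝ) ^ (n + 1)) * (-1) ^ (n + 1) = 1 := by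
      rw [← mul_pow]; simp
    have hreal : (2 ^ α - 1) / (2 * Real.pi) ^ (α - 1) * Real.Gamma α * Z =
        (-1) ^ (n + 1) * ((-1) ^ (n + 1) * Real.pi *
          (2 * Real.pi ^ (-α) * Real.Gamma α * A)) := by
      have h2 : (2 : ℝ) ^ α ≠ 0 := by positivity
      have hpi : Real.pi ^ α ≠ 0 := (Real.rpow_pos_of_pos Real.pi_pos α).ne'
      rw [Real.mul_rpow zero_le_two Real.pi_pos.le, Real.rpow_sub_one two_ne_zero,
        Real.rpow_sub_one Real.pi_ne_zero, Real.rpow_neg Real.pi_pos.le]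
      field_simp
      rw [pow_right_comm]
      norm_num
      linear_combination -hodd
    exact_mod_cast congrArg (fun r : ℝ => (r : ℂ)) hreal

theorem theorem5 (α : ℝ) (hα : 1 < α) :
    (Even ⌊α⌋₊ →
      (∀ τ : ℝ, 0 < τ →
        IntegrableOn (zetaIntegrand (Int.fract α) (⌊α⌋₊ / 2) τ) (Set.Ioi 0)) ∧
      IntegrableOn
        (fun τ : ℝ => ∫ x in Set.Ioi (0 : ℝ), zetaIntegrand (Int.fract α) (⌊α⌋₊ / 2) τ x)
        (Set.Ioi 0) ∧
      (((2 ^ α - 1) / (2 * Real.pi) ^ (α - 1) * Real.Gamma α : ℝ) : ℂ) * riemannZeta (α : ℂ) =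
        (-1) ^ (⌊α⌋₊ / 2) *
          ∫ τ in Set.Ioi (0 : ℝ), ∫ x in Set.Ioi (0 : ℝ),
            zetaIntegrand (Int.fract α) (⌊α⌋₊ / 2) τ x) ∧
    (Odd ⌊α⌋₊ →
      (∀ τ : ℝ, 0 < τ →
        IntegrableOn (zetaIntegrand (Int.fract α - 1) ((⌊α⌋₊ + 1) / 2) τ) (Set.Ioi 0)) ∧
      IntegrableOn
        (fun τ : ℝ =>
          ∫ x in Set.Ioi (0 : ℝ), zetaIntegrand (Int.fract α - 1) ((⌊α⌋₊ + 1) / 2) τ x)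
        (Set.Ioi 0) ∧
      (((2 ^ α - 1) / (2 * Real.pi) ^ (α - 1) * Real.Gamma α : ℝ) : ℂ) * riemannZeta (α : ℂ) =
        (-1) ^ ((⌊α⌋₊ + 1) / 2) *
          ∫ τ in Set.Ioi (0 : ℝ), ∫ x in Set.Ioi (0 : ℝ),
            zetaIntegrand (Int.fract α - 1) ((⌊α⌋₊ + 1) / 2) τ x) := by
  have hfloor : ((⌊α⌋₊ : ℕ) : ℝ) + Int.fract α = α := by
    rw [natCast_floor_eq_intCast_floor (by linarith)]
    exact Int.floor_add_fract α
  have hone : 1 ≤ ⌊α⌋₊ := Nat.one_le_floor_iff α |>.2 hα.le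
  refine ⟨fun ⟨k, hk⟩ => ?_, fun ⟨k, hk⟩ => ?_⟩
  -- Since `⌊α⌋₊ ≥ 1`, an even floor is at least 2; this excludes `p_0 = 1`, which has no factor
  -- `x`.
  · obtain ⟨n, rfl⟩ : ∃ n, k = n + 1 := ⟨k - 1, by omega⟩
    rw [show ⌊α⌋₊ / 2 = n + 1 by omega]
    refine zeta_eq_integral_zetaIntegrand hα n ?_
    rw [hk] at hfloor
    push_cast at hfloor
    linarith
  · rw [show (⌊α⌋₊ + 1) / 2 = k + 1 by omega]
    refine zeta_eq_integral_zetaIntegrand hα k ?_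
    rw [hk] at hfloor
    push_cast at hfloor
    linarith
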